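/- Let $m,n\ge 1$ be integers, let $\mu$ be a nonnegative measure on (the Borel sets of) $\mathbb{R}^n$, and let $p\in[1,\infty)$ be a real number. Put $q=p/(p-1)$ if $p>1$ and $q=\infty$ if $p=1$. Equip $(L^p_\mu(\mathbb{R}^n))^m$ (real-valued functions) with the norm $\|u\|_p=\bigl(\sum_{j=1}^m\|\hat u^{(j)}\|_p^p\bigr)^{1/p}$ for $u=(\hat u^{(1)},\dots,\hat u^{(m)})$. A sequence $u_i=(\hat u_i^{(1)},\dots,\hat u_i^{(m)})$ is said to converge weakly in $(L^p_\mu(\mathbb{R}^n))^m$ to $u$ if, for every $j=1,\dots,m$ and every $v\in L^q_\mu(\mathbb{R}^n)$, $$\lim_{i\to\infty}\int_{\mathbb{R}^n}\hat u_i^{(j)}\,v\,d\mu=\int_{\mathbb{R}^n}\hat u^{(j)}\,v\,d\mu .$$ Suppose that $\{u_i\}_{i=1}^{\infty}$ converges weakly in $(L^p_\mu(\mathbb{R}^n))^m$ to $u$. Then there are indices $i_1<i_2<\cdots$ such that $$\lim_{k\to\infty}\Bigl\|\frac1k\sum_{r=1}^k u_{i_r}-u\Bigr\|_p=0 .$$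 -/

import Mathlib

open MeasureTheory Filter Topology
open scoped ENNReal

/-- Weak convergence of a sequence `u i` of `L^p_μ(ℝⁿ)` to `u₀`, for `1 ≤ p < ∞`:
`∫ (u i) v dμ → ∫ u₀ v dμ` for every `v ∈ L^q_μ(ℝⁿ)`. Here `q = ENNReal.conjExponent p` is the
conjugate exponent: `q = p / (p - 1)` if `1 < p < ∞`, and `q = ∞` if `p = 1`. -/
def WeaklyConvergesLp {n : ℕ} (μ : Measure (EuclideanSpace ℝ (Fin n))) (p : ℝ≥0∞)
    (u : ℕ → Lp ℝ p μ) (u₀ : Lp ℝ p μ) : Prop :=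
  ∀ v : Lp ℝ (ENNReal.conjExponent p) μ,
    Tendsto (fun i => ∫ x, u i x * v x ∂μ) atTop (𝓝 (∫ x, u₀ x * v x ∂μ))

/-- The product space `(L^p_μ(ℝⁿ))^m`. For `1 ≤ p < ∞` its norm is
`‖u‖ = (∑ j, ‖u j‖_p ^ p) ^ (1 / p)`. -/
abbrev ProductLp (m n : ℕ) (μ : Measure (EuclideanSpace ℝ (Fin n))) (p : ℝ≥0∞) : Type :=
  PiLp p (fun _ : Fin m => Lp ℝ p μ)

/-- Weak convergence in `(L^p_μ(ℝⁿ))^m`: each component converges weakly in `L^p_μ(ℝⁿ)`. -/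
def WeaklyConvergesProductLp {m n : ℕ} (μ : Measure (EuclideanSpace ℝ (Fin n))) (p : ℝ≥0∞)
    (u : ℕ → ProductLp m n μ p) (u₀ : ProductLp m n μ p) : Prop :=
  ∀ j : Fin m, WeaklyConvergesLp μ p (fun i => u i j) (u₀ j)

/-! This is the Banach–Saks theorem, with Szlenk's case `p = 1`. After subtraction of the limit the
sequence is weakly null, hence bounded by some `M`. The indices are chosen one at a time, so that
the next term pairs almost to zero with the derivative of a convex functional at the current partial
sum `S`; the functional then grows only by higher-order errors.

For `p > 1` the functional is `‖S‖ ^ p`. By `abs_add_rpow_le` and `norm_add_rpow_le_step` the `k`-th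
step costs at most `2 ε M ^ p (k + 1) ^ (p - 1)` plus a constant, with `ε` arbitrary. Hence `‖S k‖ ^
p ≤ 2 ε M ^ p k ^ p + c k`, and dividing by `k ^ p` finishes.

For `p = 1` a density weight reduces the problem to a finite measure. The functional is `∫ √(l² +
S²)`, a smoothing of the `L¹` norm with second derivative of the integrand at most `1 / l`. Terms
are cut at a height `K`: the bounded part costs `O(K² / l)`, and the tails are uniformly small by a
Baire category argument (`exists_forall_setIntegral_abs_le`). So each late step costs at most `ε /
2`, and `∫ |S k| = o(k)`. -/

/-! ### Inductive selection of indices. -/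

/-- A condition on pairs (earlier indices, next index) that always holds for all large next
indices can be enforced along a strictly increasing sequence of indices. -/
theorem exists_strictMono_forall_image_range {P : Finset ℕ → ℕ → Prop}
    (hP : ∀ T, ∀ᶠ n in atTop, P T n) :
    ∃ i : ℕ → ℕ, StrictMono i ∧ ∀ k, P ((Finset.range k).image i) (i k) := by
  have hex : ∀ T : Finset ℕ, ∃ n, P T n ∧ ∀ t ∈ T, t < n := fun T =>
    ((hP T).and ((eventually_gt_atTop (T.sup id)).mono fun n hn t ht =>
      lt_of_le_of_lt (Finset.le_sup (f := id) ht) hn)).exists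
  choose next hnext hlt using hex
  let T : ℕ → Finset ℕ := fun k => Nat.rec ∅ (fun _ S => insert (next S) S) k
  have hT : ∀ k, T (k + 1) = insert (next (T k)) (T k) := fun k => rfl
  have himage : ∀ k, (Finset.range k).image (fun k => next (T k)) = T k := by
    intro k
    induction k with
    | zero => rfl
    | succ k ih => rw [Finset.range_add_one, Finset.image_insert, ih, hT]
  refine ⟨fun k => next (T k), strictMono_nat_of_lt_succ fun k => hlt _ _ ?_, fun k => ?_⟩
  · rw [hT]
    exact Finset.mem_insert_self _ _
  · rw [himage]
    exact hnext _

/-- The Cesàro means of `f` along `i` tend to zero as soon as each index is chosen far enough in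
terms of the finite set of the earlier ones. -/
def HasCesaroSelection {E : Type*} [AddCommGroup E] [Module ℝ E] [TopologicalSpace E]
    (f : ℕ → E) : Prop :=
  ∃ P : Finset ℕ → ℕ → Prop, (∀ T, ∀ᶠ n in atTop, P T n) ∧
    ∀ i : ℕ → ℕ, StrictMono i → (∀ k, P ((Finset.range k).image i) (i k)) →
      Tendsto (fun k : ℕ => (1 / (k : ℝ)) • ∑ r ∈ Finset.range k, f (i r)) atTop (𝓝 0)

/-- Finitely many eventual conditions can be met by the same next index. Cesàro convergence is not
inherited by subsequences, so a fixed good sequence for each component would not suffice. -/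
theorem exists_strictMono_of_forall_hasCesaroSelection {ι : Type*} [Finite ι] {E : ι → Type*}
    [∀ j, AddCommGroup (E j)] [∀ j, Module ℝ (E j)] [∀ j, TopologicalSpace (E j)]
    {f : ∀ j, ℕ → E j} (hf : ∀ j, HasCesaroSelection (f j)) :
    ∃ i : ℕ → ℕ, StrictMono i ∧ ∀ j,
      Tendsto (fun k : ℕ => (1 / (k : ℝ)) • ∑ r ∈ Finset.range k, f j (i r)) atTop (𝓝 0) := by
  choose P hP hlim using hf
  obtain ⟨i, hi, hPi⟩ := exists_strictMono_forall_image_range (P := fun T n => ∀ j, P j T n)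
    fun T => eventually_all.2 fun j => hP j T
  exact ⟨i, hi, fun j => hlim j i hi fun k => hPi k j⟩

theorem sum_image_range_of_strictMono {E : Type*} [AddCommMonoid E] (f : ℕ → E) {i : ℕ → ℕ}
    (hi : StrictMono i) (k : ℕ) :
    ∑ s ∈ (Finset.range k).image i, f s = ∑ r ∈ Finset.range k, f (i r) :=
  Finset.sum_image hi.injective.injOn

/-! ### Pointwise inequalities. -/

/-- The derivative of `x ↦ |x| ^ r / r`. -/
noncomputable def signedRpow (r a : ℝ) : ℝ := |a| ^ (r - 2) * a

theorem measurable_signedRpow (r : ℝ) : Measurable (signedRpow r) := by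
  unfold signedRpow
  fun_prop

theorem signedRpow_mul_self (r : ℝ) (hr : 0 < r) (a : ℝ) : signedRpow r a * a = |a| ^ r := by
  unfold signedRpow
  rcases eq_or_ne a 0 with rfl | ha
  · simp [Real.zero_rpow hr.ne']
  · have h : 0 < |a| := abs_pos.2 ha
    rw [mul_assoc, ← abs_mul_abs_self, ← mul_assoc, Real.rpow_sub h]
    norm_num
    field_simp
    exact sq_abs a

theorem abs_signedRpow {r : ℝ} (hr : 1 < r) (a : ℝ) : |signedRpow r a| = |a| ^ (r - 1) := by
  unfold signedRpow
  rcases eq_or_ne a 0 with rfl | ha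
  · simp [Real.zero_rpow (sub_pos.2 hr).ne']
  · have h : 0 < |a| := abs_pos.2 ha
    rw [abs_mul, abs_of_nonneg (Real.rpow_nonneg h.le _), ← Real.rpow_add_one h.ne']
    congr 1
    ring

theorem abs_signedRpow_one_le (a : ℝ) : |signedRpow 1 a| ≤ 1 := by
  unfold signedRpow
  rw [abs_mul, abs_of_nonneg (by positivity)]
  norm_num [Real.rpow_neg_one]
  exact inv_mul_le_one

/-- For small `t` this is differentiability at `0` with error `ε |t|`; away from `0` everything is
dominated by `|t| ^ r`. -/
theorem abs_one_add_rpow_le {r ε : ℝ} (hr : 1 < r) (hε : 0 < ε) :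
    ∃ C, 1 ≤ C ∧ ∀ t : ℝ, |1 + t| ^ r ≤ 1 + r * t + ε * |t| + C * |t| ^ r := by
  have hd : HasDerivAt (fun t : ℝ => (1 + t) ^ r) r 0 := by
    have h := ((hasDerivAt_id (0 : ℝ)).const_add 1).rpow_const (p := r) (Or.inl (by simp))
    simpa using h
  have ho := (hasDerivAt_iff_isLittleO.1 hd).def hε
  obtain ⟨δ, hδ, hball⟩ := Metric.eventually_nhds_iff.1 ho
  set η := min δ 1 with hη
  have hη0 : 0 < η := lt_min hδ one_pos
  -- For `|t| ≥ η` the first summand bounds `|1 + t| ^ r`, and the second compensates `r * t` when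
  -- `t < 0`.
  refine ⟨(1 / η + 1) ^ r + r * η ^ (1 - r), ?_, fun t => ?_⟩
  · have : 1 ≤ (1 / η + 1) ^ r := Real.one_le_rpow (by simp [hη0.le]) (by linarith)
    have : 0 ≤ r * η ^ (1 - r) := by positivity
    linarith
  rcases lt_or_ge |t| η with ht | ht
  · have h1 := hball (y := t) (by simpa using ht.trans_le (min_le_left _ _))
    have h2 : |t| < 1 := ht.trans_le (min_le_right _ _)
    have h3 : 0 < 1 + t := by linarith [neg_abs_le t]
    simp only [add_zero, Real.one_rpow, sub_zero, smul_eq_mul, Real.norm_eq_abs] at h1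
    have h4 := (le_abs_self _).trans h1
    rw [abs_of_pos h3]
    have : 0 ≤ ((1 / η + 1) ^ r + r * η ^ (1 - r)) * |t| ^ r := by positivity
    linarith
  · have ht0 : 0 < |t| := hη0.trans_le ht
    have h1 : |1 + t| ^ r ≤ (1 / η + 1) ^ r * |t| ^ r := by
      rw [← Real.mul_rpow (by positivity) ht0.le]
      refine Real.rpow_le_rpow (abs_nonneg _) ?_ (by linarith)
      have : 1 ≤ 1 / η * |t| := by
        rw [one_div, ← div_eq_inv_mul]
        exact (one_le_div hη0).2 ht
      have := abs_add_le 1 t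
      rw [abs_one] at this
      linarith
    have h2 : |t| ≤ η ^ (1 - r) * |t| ^ r := by
      have : |t| ^ (1 - r) ≤ η ^ (1 - r) :=
        Real.rpow_le_rpow_of_nonpos hη0 ht (by linarith)
      calc |t| = |t| ^ (1 - r) * |t| ^ r := by rw [← Real.rpow_add ht0]; simp
        _ ≤ _ := by gcongr
    have h3 : -(r * t) ≤ r * (η ^ (1 - r) * |t| ^ r) := by
      calc -(r * t) = r * (-t) := by ring
        _ ≤ _ := by
          have := neg_abs_le t
          gcongr
          linarith
    have : 0 ≤ ε * |t| := by positivity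
    linarith

/-- Homogeneous form of `abs_one_add_rpow_le`, with `t = b / a`; the case `a = 0` is where `1 ≤ C`
is needed. -/
theorem abs_add_rpow_le {r ε : ℝ} (hr : 1 < r) (hε : 0 < ε) :
    ∃ C, 0 ≤ C ∧ ∀ a b : ℝ, |a + b| ^ r ≤
      |a| ^ r + r * (signedRpow r a * b) + ε * (|a| ^ (r - 1) * |b|) + C * |b| ^ r := by
  obtain ⟨C, hC, h⟩ := abs_one_add_rpow_le hr hε
  refine ⟨C, by linarith, fun a b => ?_⟩
  rcases eq_or_ne a 0 with rfl | ha
  · have : 0 ≤ |b| ^ r := by positivity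
    simp [Real.zero_rpow (by linarith : r ≠ 0), Real.zero_rpow (by linarith : r - 1 ≠ 0),
      signedRpow]
    nlinarith
  · have ha0 : 0 < |a| := abs_pos.2 ha
    have h1 := mul_le_mul_of_nonneg_left (h (b / a)) (Real.rpow_nonneg ha0.le r)
    have e1 : |a| ^ r * |1 + b / a| ^ r = |a + b| ^ r := by
      rw [← Real.mul_rpow ha0.le (abs_nonneg _), ← abs_mul]
      congr 2
      field_simp
    have e2 : |a| ^ r * (b / a) = signedRpow r a * b := by
      rw [← signedRpow_mul_self r (by linarith)]
      field_simp
    have e3 : |a| ^ r * |b / a| = |a| ^ (r - 1) * |b| := by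
      rw [abs_div, Real.rpow_sub_one ha0.ne']
      field_simp
    have e4 : |a| ^ r * |b / a| ^ r = |b| ^ r := by
      rw [← Real.mul_rpow ha0.le (abs_nonneg _), ← abs_mul]
      congr 2
      field_simp
    calc |a + b| ^ r = |a| ^ r * |1 + b / a| ^ r := e1.symm
      _ ≤ _ := h1
      _ = |a| ^ r + r * (|a| ^ r * (b / a)) + ε * (|a| ^ r * |b / a|)
          + C * (|a| ^ r * |b / a| ^ r) := by ring
      _ = _ := by rw [e2, e3, e4]

/-- Young's inequality at scale `c`: compare `x` with `c * y`. With `‖x‖ ≤ c M` and `‖y‖ ≤ M` both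
terms integrate to at most `c ^ (r - 1) M ^ r`. -/
theorem rpow_sub_one_mul_le {r c x y : ℝ} (hr : 1 < r) (hc : 0 < c) (hx : 0 ≤ x) (hy : 0 ≤ y) :
    x ^ (r - 1) * y ≤ c⁻¹ * x ^ r + c ^ (r - 1) * y ^ r := by
  have key : ∀ z : ℝ, 0 ≤ z → z ^ (r - 1) * z = z ^ r := fun z hz => by
    rw [← Real.rpow_add_one' hz (by linarith)]
    ring_nf
  rcases le_total (c * y) x with h | h
  · have h1 : y ≤ c⁻¹ * x := by
      rw [← div_eq_inv_mul, le_div_iff₀ hc]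
      linarith
    calc x ^ (r - 1) * y ≤ x ^ (r - 1) * (c⁻¹ * x) := by gcongr
      _ = c⁻¹ * x ^ r := by rw [← key x hx]; ring
      _ ≤ _ := le_add_of_nonneg_right (by positivity)
  · calc x ^ (r - 1) * y ≤ (c * y) ^ (r - 1) * y := by
          gcongr
      _ = c ^ (r - 1) * y ^ r := by
          rw [← key y hy, Real.mul_rpow hc.le hy]
          ring
      _ ≤ _ := le_add_of_nonneg_left (by positivity)

/-- With `q = √(l² + a²)` and `y = l² + (a + b)²`, this is `√y ≤ (q² + y) / (2 q)`, that is `(√y -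
q)² ≥ 0`, together with `q ≥ l`. -/
theorem sqrt_sq_add_add_sq_le {l : ℝ} (hl : 0 < l) (a b : ℝ) :
    √(l ^ 2 + (a + b) ^ 2) ≤
      √(l ^ 2 + a ^ 2) + a / √(l ^ 2 + a ^ 2) * b + b ^ 2 / (2 * l) := by
  set q := √(l ^ 2 + a ^ 2) with hq
  have hq2 : q ^ 2 = l ^ 2 + a ^ 2 := Real.sq_sqrt (by positivity)
  have hlq : l ≤ q := Real.le_sqrt_of_sq_le (by nlinarith [sq_nonneg a])
  have hq0 : 0 < q := hl.trans_le hlq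
  have h1 : b ^ 2 / (2 * q) ≤ b ^ 2 / (2 * l) := by gcongr
  suffices √(l ^ 2 + (a + b) ^ 2) ≤ q + a / q * b + b ^ 2 / (2 * q) by linarith
  have e : q + a / q * b + b ^ 2 / (2 * q) = (q ^ 2 + (l ^ 2 + (a + b) ^ 2)) / (2 * q) := by
    field_simp
    linarith
  rw [e, le_div_iff₀ (by positivity)]
  nlinarith [sq_nonneg (√(l ^ 2 + (a + b) ^ 2) - q),
    Real.sq_sqrt (by positivity : 0 ≤ l ^ 2 + (a + b) ^ 2)]

theorem sqrt_sq_add_add_sq_le_add_abs (l a b : ℝ) :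
    √(l ^ 2 + (a + b) ^ 2) ≤ √(l ^ 2 + a ^ 2) + |b| := by
  have ha : |a| ≤ √(l ^ 2 + a ^ 2) := Real.abs_le_sqrt (by nlinarith [sq_nonneg l])
  refine Real.sqrt_le_left (by positivity) |>.2 ?_
  have hq2 : √(l ^ 2 + a ^ 2) ^ 2 = l ^ 2 + a ^ 2 := Real.sq_sqrt (by positivity)
  have : a * b ≤ √(l ^ 2 + a ^ 2) * |b| :=
    (le_abs_self _).trans (by rw [abs_mul]; gcongr)
  nlinarith [sq_abs b]

theorem abs_div_sqrt_sq_add_sq_le_one (l a : ℝ) : |a / √(l ^ 2 + a ^ 2)| ≤ 1 := by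
  rw [abs_div, abs_of_nonneg (Real.sqrt_nonneg _)]
  exact div_le_one_of_le₀ (Real.abs_le_sqrt (by nlinarith [sq_nonneg l])) (Real.sqrt_nonneg _)

/-! ### Boundedness of weakly null sequences and the case `1 < p < ∞`. -/

section
variable {α : Type*} [MeasurableSpace α] {μ : Measure α} {p : ℝ≥0∞}

theorem MeasureTheory.Lp.norm_rpow_eq_integral (hp0 : p ≠ 0) (hp : p ≠ ∞) (f : Lp ℝ p μ) :
    ‖f‖ ^ p.toReal = ∫ x, |f x| ^ p.toReal ∂μ := by
  have hr : 0 < p.toReal := ENNReal.toReal_pos hp0 hp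
  have hn : 0 ≤ ∫ x, |f x| ^ p.toReal ∂μ := integral_nonneg fun x => by positivity
  rw [Lp.norm_def, (Lp.memLp f).eLpNorm_eq_integral_rpow_norm hp0 hp,
    ENNReal.toReal_ofReal (Real.rpow_nonneg (integral_nonneg fun x => by positivity) _)]
  simp only [Real.norm_eq_abs]
  rw [Real.rpow_inv_rpow hn hr.ne']

theorem MeasureTheory.Lp.integrable_abs_rpow (hp0 : p ≠ 0) (hp : p ≠ ∞) (f : Lp ℝ p μ) :
    Integrable (fun x => |f x| ^ p.toReal) μ :=
  (Lp.memLp f).integrable_norm_rpow hp0 hp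

theorem ENNReal.one_le_toReal [Fact (1 ≤ p)] (hp : p ≠ ∞) : 1 ≤ p.toReal := by
  simpa using ENNReal.toReal_mono hp (Fact.out : 1 ≤ p)

theorem ENNReal.div_sub_one_eq_conjExponent (h1 : 1 < p) (hp : p ≠ ∞) :
    p / (p - 1) = ENNReal.conjExponent p := by
  have h0 : p - 1 ≠ 0 := (tsub_pos_of_lt h1).ne'
  have ht : p - 1 ≠ ∞ := ENNReal.sub_ne_top hp
  conv_lhs => rw [← tsub_add_cancel_of_le h1.le]
  rw [ENNReal.add_div, ENNReal.add_sub_cancel_right ENNReal.one_ne_top, ENNReal.div_self h0 ht,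
    ENNReal.conjExponent, one_div]

/-- For `p > 1` the signed power has modulus `|f| ^ (p - 1)`, and `q (p - 1) = p`. For `p = 1` it is
the sign of `f`, and the right-hand side is `1`. -/
theorem memLp_signedRpow [Fact (1 ≤ p)] (hp : p ≠ ∞) {f : α → ℝ} (hf : MemLp f p μ) :
    MemLp (fun x => signedRpow p.toReal (f x)) (ENNReal.conjExponent p) μ ∧
      eLpNorm (fun x => signedRpow p.toReal (f x)) (ENNReal.conjExponent p) μ ≤
        eLpNorm f p μ ^ (p.toReal - 1) := by
  have hm : AEStronglyMeasurable (fun x => signedRpow p.toReal (f x)) μ :=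
    ((measurable_signedRpow _).comp_aemeasurable hf.aemeasurable).aestronglyMeasurable
  suffices eLpNorm (fun x => signedRpow p.toReal (f x)) (ENNReal.conjExponent p) μ ≤
      eLpNorm f p μ ^ (p.toReal - 1) from
    ⟨⟨hm, this.trans_lt (ENNReal.rpow_lt_top_of_nonneg
      (sub_nonneg.2 (ENNReal.one_le_toReal hp)) hf.2.ne)⟩, this⟩
  rcases eq_or_lt_of_le (Fact.out : 1 ≤ p) with rfl | h1
  · simp only [ENNReal.conjExponent, tsub_self, ENNReal.inv_zero, add_top, ENNReal.toReal_one,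
      sub_self, ENNReal.rpow_zero]
    have := eLpNormEssSup_le_of_ae_bound (μ := μ) (f := fun x => signedRpow 1 (f x)) (C := 1)
      (Eventually.of_forall fun x =>
        abs_signedRpow_one_le _)
    simpa using this
  · have hr : 1 < p.toReal := by
      simpa using (ENNReal.toReal_lt_toReal ENNReal.one_ne_top hp).2 h1
    have h2 : (p - 1).toReal = p.toReal - 1 := by
      rw [ENNReal.toReal_sub_of_le h1.le hp, ENNReal.toReal_one]
    have h3 : ENNReal.conjExponent p * ENNReal.ofReal (p.toReal - 1) = p := by
      rw [← h2, ENNReal.ofReal_toReal (ENNReal.sub_ne_top hp),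
        ← ENNReal.div_sub_one_eq_conjExponent h1 hp,
        ENNReal.div_mul_cancel (tsub_pos_of_lt h1).ne' (ENNReal.sub_ne_top hp)]
    have h4 := eLpNorm_norm_rpow (p := ENNReal.conjExponent p) (μ := μ) f (sub_pos.2 hr)
    rw [h3] at h4
    rw [← h4]
    refine eLpNorm_mono fun x => ?_
    rw [Real.norm_eq_abs, abs_signedRpow hr, Real.norm_eq_abs, Real.norm_eq_abs]
    exact le_abs_self _

/-- A weakly null sequence in `L^p` is bounded in norm. -/
theorem exists_norm_le_of_weaklyNull [Fact (1 ≤ p)] (hp : p ≠ ∞) {f : ℕ → Lp ℝ p μ}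
    (hf : ∀ v : Lp ℝ (ENNReal.conjExponent p) μ,
      Tendsto (fun i => ∫ x, f i x * v x ∂μ) atTop (𝓝 0)) :
    ∃ M, 0 ≤ M ∧ ∀ i, ‖f i‖ ≤ M := by
  have hq1 : Fact (1 ≤ ENNReal.conjExponent p) := ⟨by simp [ENNReal.conjExponent]⟩
  have hp0 : p ≠ 0 := (one_pos.trans_le (Fact.out : 1 ≤ p)).ne'
  have hr0 : 0 < p.toReal := ENNReal.toReal_pos hp0 hp
  have hr1 : 1 ≤ p.toReal := ENNReal.one_le_toReal hp
  let T : ℕ → Lp ℝ (ENNReal.conjExponent p) μ →L[ℝ] ℝ := fun i =>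
    (ContinuousLinearMap.mul ℝ ℝ).lpPairing μ p (ENNReal.conjExponent p) (f i)
  have hT : ∀ i v, T i v = ∫ x, f i x * v x ∂μ := fun i v => by
    simp [T, ContinuousLinearMap.lpPairing_eq_integral]
  -- Uniform boundedness applies to the functionals induced on `L^q`. Duality is not needed: testing
  -- against the signed power of `f i` bounds `‖f i‖` by the norm of its functional.
  obtain ⟨C, hC⟩ := banach_steinhaus (g := T) fun v => by
    obtain ⟨C, hC⟩ := ((hf v).norm.bddAbove_range)
    exact ⟨C, fun i => by rw [hT]; exact hC ⟨i, rfl⟩⟩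
  have hC0 : 0 ≤ C := (norm_nonneg _).trans (hC 0)
  refine ⟨C, hC0, fun i => ?_⟩
  obtain ⟨hJ, hJle⟩ := memLp_signedRpow hp (Lp.memLp (f i))
  have h1 : T i (hJ.toLp _) = ‖f i‖ ^ p.toReal := by
    rw [hT, Lp.norm_rpow_eq_integral hp0 hp]
    refine integral_congr_ae (hJ.coeFn_toLp.mono fun x hx => ?_)
    simp only [hx]
    rw [mul_comm, signedRpow_mul_self _ hr0]
  have h2 : ‖hJ.toLp _‖ ≤ ‖f i‖ ^ (p.toReal - 1) := by
    rw [Lp.norm_toLp, Lp.norm_def, ENNReal.toReal_rpow]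
    exact ENNReal.toReal_mono (ENNReal.rpow_ne_top_of_nonneg (sub_nonneg.2 hr1)
      (Lp.memLp (f i)).2.ne) hJle
  have h3 : ‖f i‖ ^ p.toReal ≤ C * ‖f i‖ ^ (p.toReal - 1) := by
    rw [← h1]
    calc T i (hJ.toLp _) ≤ ‖T i (hJ.toLp _)‖ := le_abs_self _
      _ ≤ ‖T i‖ * ‖hJ.toLp _‖ := (T i).le_opNorm _
      _ ≤ _ := by gcongr; exact hC i
  rcases (norm_nonneg (f i)).eq_or_lt with h | h
  · rw [← h]; exact hC0
  · rw [Real.rpow_sub_one h.ne', ← mul_div_assoc, le_div_iff₀ h, mul_comm] at h3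
    exact le_of_mul_le_mul_right h3 (by positivity)

/-- Growth of the `r`-th powers of the norms of partial sums. -/
theorem le_mul_rpow_of_step {r a c : ℝ} (hr : 1 < r) (ha : 0 ≤ a) {A : ℕ → ℝ}
    (h0 : A 0 = 0) (hstep : ∀ k, A (k + 1) ≤ A k + a * ((k : ℝ) + 1) ^ (r - 1) + c) (k : ℕ) :
    A k ≤ a * (k : ℝ) ^ r + c * k := by
  have key : ∀ k : ℕ, A k ≤ k * (a * (k : ℝ) ^ (r - 1) + c) := by
    intro k
    induction k with
    | zero => simp [h0]
    | succ k ih =>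
      have h1 : (k : ℝ) ^ (r - 1) ≤ ((k : ℝ) + 1) ^ (r - 1) :=
        Real.rpow_le_rpow (by positivity) (by linarith) (by linarith)
      have h2 : (k : ℝ) * (a * (k : ℝ) ^ (r - 1)) ≤ k * (a * ((k : ℝ) + 1) ^ (r - 1)) := by
        gcongr
      push_cast
      linarith [hstep k]
  refine (key k).trans (le_of_eq ?_)
  have : (k : ℝ) ^ r = (k : ℝ) ^ (r - 1) * k := by
    rw [← Real.rpow_add_one' (by positivity) (by linarith)]
    ring_nf
  rw [this]
  ring

/-- One step of the estimate of the `r`-th powers of the norms of partial sums. -/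
theorem norm_add_rpow_le_step [Fact (1 ≤ p)] (h1 : 1 < p) (hp : p ≠ ∞) {ε C M : ℝ} (hε : 0 < ε)
    (hC : 0 ≤ C) (hCab : ∀ a b : ℝ, |a + b| ^ p.toReal ≤ |a| ^ p.toReal
      + p.toReal * (signedRpow p.toReal a * b) + ε * (|a| ^ (p.toReal - 1) * |b|)
      + C * |b| ^ p.toReal) {c : ℝ} (hc : 0 < c) {S g : Lp ℝ p μ} (hM : 0 ≤ M)
    (hS : ‖S‖ ≤ c * M) (hg : ‖g‖ ≤ M)
    (hSg : ∫ x, signedRpow p.toReal (S x) * g x ∂μ ≤ 1) :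
    ‖S + g‖ ^ p.toReal ≤ ‖S‖ ^ p.toReal
      + 2 * ε * M ^ p.toReal * c ^ (p.toReal - 1) + (p.toReal + C * M ^ p.toReal) := by
  have hr : 1 < p.toReal := by
    simpa using (ENNReal.toReal_lt_toReal ENNReal.one_ne_top hp).2 h1
  have hp0 : p ≠ 0 := (one_pos.trans h1).ne'
  set r := p.toReal with hrdef
  have iS := Lp.integrable_abs_rpow hp0 hp S
  have ig := Lp.integrable_abs_rpow hp0 hp g
  have iSg : Integrable (fun x => signedRpow r (S x) * g x) μ :=
    (memLp_signedRpow hp (Lp.memLp S)).1.integrable_mul (Lp.memLp g)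
  have hint : ‖S + g‖ ^ r ≤ ∫ x, ((1 + ε * c⁻¹) * |S x| ^ r + r * (signedRpow r (S x) * g x)
      + (ε * c ^ (r - 1) + C) * |g x| ^ r) ∂μ := by
    rw [Lp.norm_rpow_eq_integral hp0 hp]
    refine integral_mono_ae (Lp.integrable_abs_rpow hp0 hp _)
      (((iS.const_mul _).add (iSg.const_mul _)).add (ig.const_mul _)) ?_
    filter_upwards [Lp.coeFn_add S g] with x hx
    rw [hx, Pi.add_apply]
    have h2 := hCab (S x) (g x)
    have h3 := mul_le_mul_of_nonneg_left
      (rpow_sub_one_mul_le hr hc (abs_nonneg (S x)) (abs_nonneg (g x))) hε.le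
    linarith
  have iS' := iS.const_mul (1 + ε * c⁻¹)
  have iSg' := iSg.const_mul r
  have iSum : Integrable (fun x => (1 + ε * c⁻¹) * |S x| ^ r
      + r * (signedRpow r (S x) * g x)) μ := iS'.add iSg'
  rw [integral_add iSum (ig.const_mul _), integral_add iS' iSg', integral_const_mul, integral_const_mul,
    integral_const_mul, ← Lp.norm_rpow_eq_integral hp0 hp, ← Lp.norm_rpow_eq_integral hp0 hp]
    at hint
  have hS' : ‖S‖ ^ r ≤ c ^ r * M ^ r := by
    rw [← Real.mul_rpow hc.le hM]
    gcongr
  have hg' : ‖g‖ ^ r ≤ M ^ r := by gcongr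
  have hcr : c⁻¹ * c ^ r = c ^ (r - 1) := by
    rw [Real.rpow_sub_one hc.ne']
    field_simp
  refine hint.trans ?_
  calc (1 + ε * c⁻¹) * ‖S‖ ^ r + r * (∫ x, signedRpow r (S x) * g x ∂μ)
        + (ε * c ^ (r - 1) + C) * ‖g‖ ^ r
      = ‖S‖ ^ r + ε * c⁻¹ * ‖S‖ ^ r + r * (∫ x, signedRpow r (S x) * g x ∂μ)
        + (ε * c ^ (r - 1) + C) * ‖g‖ ^ r := by ring
    _ ≤ ‖S‖ ^ r + ε * c⁻¹ * (c ^ r * M ^ r) + r * 1 + (ε * c ^ (r - 1) + C) * M ^ r := by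
        gcongr
    _ = ‖S‖ ^ r + ε * (c⁻¹ * c ^ r) * M ^ r + r * 1 + (ε * c ^ (r - 1) + C) * M ^ r := by ring
    _ = _ := by rw [hcr]; ring

theorem hasCesaroSelection_of_weaklyNull_of_one_lt [Fact (1 ≤ p)] (h1 : 1 < p) (hp : p ≠ ∞)
    {f : ℕ → Lp ℝ p μ} (hf : ∀ v : Lp ℝ (ENNReal.conjExponent p) μ,
      Tendsto (fun i => ∫ x, f i x * v x ∂μ) atTop (𝓝 0)) :
    HasCesaroSelection f := by
  have hr : 1 < p.toReal := by
    simpa using (ENNReal.toReal_lt_toReal ENNReal.one_ne_top hp).2 h1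
  have hr0 : 0 < p.toReal := one_pos.trans hr
  obtain ⟨M, hM, hfM⟩ := exists_norm_le_of_weaklyNull hp hf
  refine ⟨fun T n => ∫ x, signedRpow p.toReal ((∑ s ∈ T, f s : Lp ℝ p μ) x) * f n x ∂μ ≤ 1,
    fun T => ?_, fun i hi hPi => ?_⟩
  · obtain ⟨hJ, -⟩ := memLp_signedRpow hp (Lp.memLp (∑ s ∈ T, f s))
    filter_upwards [(hf (hJ.toLp _)).eventually (gt_mem_nhds one_pos)] with n hn
    refine le_of_eq_of_le (integral_congr_ae (hJ.coeFn_toLp.mono fun x hx => ?_)) hn.le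
    simp only [hx]
    rw [mul_comm]
  set S : ℕ → Lp ℝ p μ := fun k => ∑ r ∈ Finset.range k, f (i r) with hSdef
  have hS : ∀ k, ‖S k‖ ≤ k * M := fun k => by
    simpa using norm_sum_le_of_le (Finset.range k) (f := fun r => f (i r)) fun r _ => hfM (i r)
  have hPi' : ∀ k, ∫ x, signedRpow p.toReal (S k x) * f (i k) x ∂μ ≤ 1 := fun k => by
    have := hPi k
    simp only at this
    rwa [sum_image_range_of_strictMono f hi k] at this
  have hgrowth : ∀ ε > 0, ∃ c, ∀ k : ℕ,
      ‖S k‖ ^ p.toReal ≤ 2 * ε * M ^ p.toReal * (k : ℝ) ^ p.toReal + c * k := by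
    intro ε hε
    obtain ⟨C, hC, hCab⟩ := abs_add_rpow_le hr hε
    refine ⟨p.toReal + C * M ^ p.toReal, le_mul_rpow_of_step hr (by positivity)
      (by simp [hSdef, Real.zero_rpow hr0.ne']) fun k => ?_⟩
    have : S (k + 1) = S k + f (i k) := Finset.sum_range_succ _ _
    rw [this]
    -- The scale is `c = k + 1` rather than `k`, since it must be positive at `k = 0`.
    refine norm_add_rpow_le_step h1 hp hε hC hCab (by positivity) hM ((hS k).trans ?_) (hfM _)
      (hPi' k)
    gcongr
    linarith
  have hlim : Tendsto (fun k : ℕ => ‖(1 / (k : ℝ)) • S k‖ ^ p.toReal) atTop (𝓝 0) := by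
    rw [Metric.tendsto_atTop']
    intro δ hδ
    obtain ⟨ε, hε, hεδ⟩ : ∃ ε > 0, 2 * ε * M ^ p.toReal < δ / 2 := by
      refine ⟨δ / 4 / (M ^ p.toReal + 1), by positivity, ?_⟩
      have : M ^ p.toReal / (M ^ p.toReal + 1) < 1 := by
        rw [div_lt_one (by positivity)]
        linarith
      calc _ = δ / 2 * (M ^ p.toReal / (M ^ p.toReal + 1)) := by ring
        _ < δ / 2 * 1 := by gcongr
        _ = _ := mul_one _
    obtain ⟨c, hc⟩ := hgrowth ε hε
    have hdecay : Tendsto (fun k : ℕ => c * (k : ℝ) ^ (-(p.toReal - 1))) atTop (𝓝 0) := by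
      simpa using ((tendsto_rpow_neg_atTop (sub_pos.2 hr)).comp
        tendsto_natCast_atTop_atTop).const_mul c
    obtain ⟨N, hN⟩ := eventually_atTop.1 (hdecay.eventually (gt_mem_nhds (half_pos hδ)))
    refine ⟨N, fun k hk => ?_⟩
    have hk0 : (0 : ℝ) < k := by exact_mod_cast (Nat.zero_le N).trans_lt hk
    rw [Real.dist_0_eq_abs, abs_of_nonneg (by positivity), norm_smul,
      Real.mul_rpow (norm_nonneg _) (norm_nonneg _), Real.norm_of_nonneg (by positivity),
      Real.div_rpow zero_le_one hk0.le, Real.one_rpow]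
    have hkr : (0 : ℝ) < (k : ℝ) ^ p.toReal := by positivity
    calc 1 / (k : ℝ) ^ p.toReal * ‖S k‖ ^ p.toReal
        ≤ 1 / (k : ℝ) ^ p.toReal * (2 * ε * M ^ p.toReal * (k : ℝ) ^ p.toReal + c * k) := by
          gcongr
          exact hc k
      _ = 2 * ε * M ^ p.toReal + c * (k : ℝ) ^ (-(p.toReal - 1)) := by
          rw [neg_sub, Real.rpow_sub hk0, Real.rpow_one]
          field_simp
      _ < δ / 2 + δ / 2 := add_lt_add hεδ (hN k hk.le)
      _ = δ := add_halves δ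
  rw [tendsto_zero_iff_norm_tendsto_zero]
  have := hlim.rpow_const (p := p.toReal⁻¹) (Or.inr (by positivity))
  rw [Real.zero_rpow (inv_pos.2 hr0).ne'] at this
  refine this.congr fun k => ?_
  rw [Real.rpow_rpow_inv (norm_nonneg _) hr0.ne']

end

/-! ### Asymptotic equi-integrability and partial sums in `L¹` of a finite measure. -/

section
variable {α : Type*} [MeasurableSpace α] {ν : Measure α}

/-- The nearest point of `[-1, 1]`. -/
noncomputable def clampUnit (x : ℝ) : ℝ := max (-1) (min 1 x)

theorem continuous_clampUnit : Continuous clampUnit := by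
  unfold clampUnit
  fun_prop

theorem abs_clampUnit_le (x : ℝ) : |clampUnit x| ≤ 1 :=
  abs_le.2 ⟨le_max_left _ _, max_le (by norm_num) (min_le_left _ _)⟩

theorem clampUnit_of_abs_le {x : ℝ} (hx : |x| ≤ 1) : clampUnit x = x := by
  rw [clampUnit, min_eq_right (abs_le.1 hx).2, max_eq_right (abs_le.1 hx).1]

theorem isClosed_setOf_abs_integral_mul_clampUnit_le {h : α → ℝ} (hi : Integrable h ν) (ε : ℝ) :
    IsClosed {v : Lp ℝ 1 ν | |∫ x, h x * clampUnit (v x) ∂ν| ≤ ε} := by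
  refine IsSeqClosed.isClosed fun v v₀ hv hlim => ?_
  obtain ⟨φ, -, hφ⟩ := (tendstoInMeasure_of_tendsto_Lp hlim).exists_seq_tendsto_ae
  have hint : Tendsto (fun n => ∫ x, h x * clampUnit (v (φ n) x) ∂ν) atTop
      (𝓝 (∫ x, h x * clampUnit (v₀ x) ∂ν)) := by
    refine tendsto_integral_of_dominated_convergence (fun x => |h x|) (fun n => ?_) hi.abs
      (fun n => Eventually.of_forall fun x => ?_) ?_
    · exact hi.aestronglyMeasurable.mul
        (continuous_clampUnit.comp_aestronglyMeasurable (Lp.aestronglyMeasurable _))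
    · rw [Real.norm_eq_abs, abs_mul]
      exact mul_le_of_le_one_right (abs_nonneg _) (abs_clampUnit_le _)
    · filter_upwards [hφ] with x hx
      exact ((continuous_clampUnit.tendsto _).comp hx).const_mul _
  exact le_of_tendsto hint.abs (Eventually.of_forall fun n => hv (φ n))

/-- A sequence of integrable functions on a finite measure space whose integrals against bounded
measurable functions tend to zero is asymptotically equi-integrable. -/
theorem exists_forall_setIntegral_abs_le [IsFiniteMeasure ν] {h : ℕ → α → ℝ}
    (hm : ∀ i, Measurable (h i)) (hi : ∀ i, Integrable (h i) ν)
    (hweak : ∀ v : α → ℝ, Measurable v → (∀ x, |v x| ≤ 1) →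
      Tendsto (fun i => ∫ x, h i x * v x ∂ν) atTop (𝓝 0)) {ε : ℝ} (hε : 0 < ε) :
    ∃ δ > 0, ∃ N, ∀ i ≥ N, ∀ E, MeasurableSet E → ν E < δ → ∫ x in E, |h i x| ∂ν ≤ ε := by
  -- Baire's theorem in `L¹(ν)`: clamping turns each `L¹` function into an admissible bounded test
  -- function, so the closed sets `B N` cover the space and one of them contains a ball.
  let B : ℕ → Set (Lp ℝ 1 ν) := fun N =>
    ⋂ i ≥ N, {v : Lp ℝ 1 ν | |∫ x, h i x * clampUnit (v x) ∂ν| ≤ ε / 2}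
  have hBclosed : ∀ N, IsClosed (B N) := fun N => isClosed_iInter fun i => isClosed_iInter fun _ =>
    isClosed_setOf_abs_integral_mul_clampUnit_le (hi i) _
  have hBunion : ⋃ N, B N = Set.univ := by
    refine Set.eq_univ_of_forall fun v => Set.mem_iUnion.2 ?_
    have h1 := (hweak (fun x => clampUnit (v x))
      (continuous_clampUnit.measurable.comp (Lp.stronglyMeasurable v).measurable)
      fun x => abs_clampUnit_le _).abs
    rw [abs_zero] at h1
    obtain ⟨N, hN⟩ := eventually_atTop.1 (h1.eventually (gt_mem_nhds (half_pos hε)))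
    exact ⟨N, Set.mem_iInter₂.2 fun i hiN => (hN i hiN).le⟩
  obtain ⟨N, v₀, hv₀⟩ := nonempty_interior_of_iUnion_of_closed hBclosed hBunion
  obtain ⟨ρ, hρ, hball⟩ := Metric.mem_nhds_iff.1 (mem_interior_iff_mem_nhds.1 hv₀)
  have hv₀i : Integrable v₀ ν := L1.integrable_coeFn v₀
  have hv₀m : Measurable v₀ := (Lp.stronglyMeasurable v₀).measurable
  have hfin : ∫⁻ x, ENNReal.ofReal (|v₀ x| + 1) ∂ν ≠ ∞ :=
    (hv₀i.abs.add (integrable_const 1)).lintegral_lt_top.ne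
  -- Replacing `v₀` on a set of measure below `δ` by a function bounded by `1` moves it by less than
  -- `ρ` in `L¹`.
  obtain ⟨δ, hδ, hδE⟩ := exists_pos_setLIntegral_lt_of_measure_lt hfin
    (ENNReal.ofReal_pos.2 hρ).ne'
  refine ⟨δ, hδ, N, fun i hiN E hE hνE => ?_⟩
  have perturb : ∀ s : α → ℝ, Measurable s → (∀ x, |s x| ≤ 1) →
      |∫ x, h i x * E.indicator s x + h i x * Eᶜ.indicator (fun x => clampUnit (v₀ x)) x ∂ν|
        ≤ ε / 2 := by
    classical
    intro s hs hs1
    have hdiff : ∀ x, ‖E.piecewise s v₀ x - v₀ x‖ₑ ≤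
        E.indicator (fun x => ENNReal.ofReal (|v₀ x| + 1)) x := by
      intro x
      by_cases hx : x ∈ E
      · rw [Set.piecewise_eq_of_mem _ _ _ hx, Set.indicator_of_mem hx, ← ofReal_norm]
        refine ENNReal.ofReal_le_ofReal ((norm_sub_le _ _).trans ?_)
        rw [Real.norm_eq_abs, Real.norm_eq_abs]
        linarith [hs1 x]
      · simp [hx]
    have hlt : ∫⁻ x, ‖E.piecewise s v₀ x - v₀ x‖ₑ ∂ν < ENNReal.ofReal ρ := by
      refine (lintegral_mono hdiff).trans_lt ?_
      rw [lintegral_indicator hE]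
      exact hδE E hνE
    have hgm : Measurable (E.piecewise s v₀) := hs.piecewise hE hv₀m
    have hgi : Integrable (E.piecewise s v₀) ν := by
      have : Integrable (fun x => E.piecewise s v₀ x - v₀ x) ν :=
        ⟨(hgm.sub hv₀m).aestronglyMeasurable, hlt.trans ENNReal.ofReal_lt_top⟩
      refine (this.add hv₀i).congr (Eventually.of_forall fun x => ?_)
      simp
    have hmem : hgi.toL1 ∈ Metric.ball v₀ ρ := by
      rw [Metric.mem_ball, Lp.dist_def, eLpNorm_one_eq_lintegral_enorm]
      refine (ENNReal.toReal_lt_of_lt_ofReal (lt_of_eq_of_lt (lintegral_congr_ae ?_) hlt))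
      filter_upwards [hgi.coeFn_toL1] with x hx
      rw [Pi.sub_apply, hx]
    have hB := Set.mem_iInter₂.1 (hball hmem) i hiN
    refine le_of_eq_of_le (congrArg _ (integral_congr_ae ?_)) hB
    filter_upwards [hgi.coeFn_toL1] with x hx
    rw [hx]
    by_cases hxE : x ∈ E
    · simp [hxE, clampUnit_of_abs_le (hs1 x)]
    · simp [hxE]
  -- Replacing `v₀` on `E` by the sign of `h i` and by `0`, then subtracting, cancels the integral
  -- over `Eᶜ` and leaves `∫_E |h i|`.
  have hsgn : Measurable fun x => signedRpow 1 (h i x) := (measurable_signedRpow 1).comp (hm i)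
  have p1 := perturb _ hsgn fun x => abs_signedRpow_one_le _
  have p0 := perturb (fun _ => 0) measurable_const (by simp)
  have i1 : Integrable (fun x => h i x * E.indicator (fun x => signedRpow 1 (h i x)) x) ν := by
    refine (hi i).mul_bdd (c := 1) (hsgn.indicator hE).aestronglyMeasurable
      (Eventually.of_forall fun x => ?_)
    exact (norm_indicator_le_norm_self _ _).trans (abs_signedRpow_one_le _)
  have i2 : Integrable (fun x => h i x * Eᶜ.indicator (fun x => clampUnit (v₀ x)) x) ν := by
    refine (hi i).mul_bdd (c := 1) ((continuous_clampUnit.measurable.comp hv₀m).indicator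
      hE.compl).aestronglyMeasurable (Eventually.of_forall fun x => ?_)
    exact (norm_indicator_le_norm_self _ _).trans (abs_clampUnit_le _)
  rw [integral_add i1 i2] at p1
  simp only [Set.indicator_zero, mul_zero, zero_add] at p0
  have e : ∫ x, h i x * E.indicator (fun x => signedRpow 1 (h i x)) x ∂ν =
      ∫ x in E, |h i x| ∂ν := by
    rw [← integral_indicator hE]
    congr 1 with x
    by_cases hxE : x ∈ E
    · have := signedRpow_mul_self 1 one_pos (h i x)
      rw [Real.rpow_one] at this
      simp [hxE, ← this, mul_comm]
    · simp [hxE]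
  rw [e] at p1
  linarith [(abs_le.1 p1).2, (abs_le.1 p0).1]

theorem MeasureTheory.Integrable.sqrt_sq_add_sq [IsFiniteMeasure ν] {S : α → ℝ}
    (hS : Integrable S ν) (l : ℝ) : Integrable (fun x => √(l ^ 2 + S x ^ 2)) ν := by
  refine ((integrable_const |l|).add hS.abs).mono' ?_ (Eventually.of_forall fun x => ?_)
  · exact (by fun_prop : Continuous fun y : ℝ => √(l ^ 2 + y ^ 2)).comp_aestronglyMeasurable
      hS.aestronglyMeasurable
  · rw [Real.norm_of_nonneg (Real.sqrt_nonneg _)]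
    have := sqrt_sq_add_add_sq_le_add_abs l 0 (S x)
    simpa [Real.sqrt_sq_eq_abs] using this

theorem integral_sqrt_sq_add_add_sq_le_add_abs [IsFiniteMeasure ν] {S g : α → ℝ}
    (hS : Integrable S ν) (hg : Integrable g ν) (l : ℝ) :
    ∫ x, √(l ^ 2 + (S x + g x) ^ 2) ∂ν ≤ ∫ x, √(l ^ 2 + S x ^ 2) ∂ν + ∫ x, |g x| ∂ν := by
  rw [← integral_add (hS.sqrt_sq_add_sq l) hg.abs]
  exact integral_mono ((hS.add hg).sqrt_sq_add_sq l) ((hS.sqrt_sq_add_sq l).add hg.abs)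
    fun x => sqrt_sq_add_add_sq_le_add_abs l _ _

/-- Where `|g| ≤ K` the second-order bound applies. Elsewhere the Lipschitz bound costs `|g|`, and
reinstating the linear term costs another `|g|`; hence the factor `2`. -/
theorem integral_sqrt_sq_add_add_sq_le [IsFiniteMeasure ν] {S g : α → ℝ}
    (hS : Integrable S ν) (hSm : Measurable S) (hg : Integrable g ν) (hgm : Measurable g)
    {l : ℝ} (hl : 0 < l) (K : ℝ) :
    ∫ x, √(l ^ 2 + (S x + g x) ^ 2) ∂ν ≤ ∫ x, √(l ^ 2 + S x ^ 2) ∂ν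
      + ∫ x, S x / √(l ^ 2 + S x ^ 2) * g x ∂ν
      + (K ^ 2 / (2 * l) * ν.real Set.univ + 2 * ∫ x in {x | K < |g x|}, |g x| ∂ν) := by
  have hE : MeasurableSet {x | K < |g x|} := measurableSet_lt measurable_const (by fun_prop)
  have i0 := hS.sqrt_sq_add_sq l
  have i1 : Integrable (fun x => S x / √(l ^ 2 + S x ^ 2) * g x) ν :=
    hg.bdd_mul (c := 1) (by fun_prop : Measurable _).aestronglyMeasurable
      (Eventually.of_forall fun x => abs_div_sqrt_sq_add_sq_le_one l _)
  have i2 : Integrable ({x | K < |g x|}.indicator fun x => |g x|) ν := hg.abs.indicator hE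
  have i01 : Integrable (fun x => √(l ^ 2 + S x ^ 2) + S x / √(l ^ 2 + S x ^ 2) * g x) ν :=
    i0.add i1
  have i23 : Integrable
      (fun x => K ^ 2 / (2 * l) + 2 * {x | K < |g x|}.indicator (fun x => |g x|) x) ν :=
    (integrable_const _).add (i2.const_mul 2)
  have e : K ^ 2 / (2 * l) * ν.real Set.univ + 2 * ∫ x in {x | K < |g x|}, |g x| ∂ν =
      ∫ x, (K ^ 2 / (2 * l) + 2 * {x | K < |g x|}.indicator (fun x => |g x|) x) ∂ν := by
    rw [integral_add (integrable_const _) (i2.const_mul 2), integral_const_mul,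
      integral_indicator hE, integral_const, smul_eq_mul, mul_comm]
  rw [e, ← integral_add i0 i1, ← integral_add i01 i23]
  refine integral_mono ((hS.add hg).sqrt_sq_add_sq l) (i01.add i23) fun x => ?_
  by_cases hx : K < |g x|
  · rw [Set.indicator_of_mem (by exact hx)]
    have h1 := sqrt_sq_add_add_sq_le_add_abs l (S x) (g x)
    have h2 : |S x / √(l ^ 2 + S x ^ 2) * g x| ≤ |g x| := by
      rw [abs_mul]
      exact mul_le_of_le_one_left (abs_nonneg _) (abs_div_sqrt_sq_add_sq_le_one l _)
    have h3 : 0 ≤ K ^ 2 / (2 * l) := by positivity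
    linarith [(abs_le.1 h2).1]
  · rw [Set.indicator_of_notMem (by exact hx)]
    have h1 := sqrt_sq_add_add_sq_le hl (S x) (g x)
    have h2 : g x ^ 2 / (2 * l) ≤ K ^ 2 / (2 * l) := by
      rw [← sq_abs (g x)]
      gcongr
      exact not_lt.1 hx
    linarith

theorem le_add_mul_of_step {A : ℕ → ℝ} {M ε : ℝ} {R : ℕ} (hM : 0 ≤ M) (hε : 0 ≤ ε)
    (h1 : ∀ k, A (k + 1) ≤ A k + M) (h2 : ∀ k ≥ R, A (k + 1) ≤ A k + ε) (k : ℕ) :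
    A k ≤ A 0 + R * M + ε * k := by
  have key : ∀ k : ℕ, A k ≤ A 0 + (min k R : ℕ) * M + ε * k := by
    intro k
    induction k with
    | zero => simp
    | succ k ih =>
      push_cast [Nat.cast_succ] at ih ⊢
      rcases lt_or_ge k R with hk | hk
      · have e1 : min ((k : ℝ)) R = k := min_eq_left (by exact_mod_cast hk.le)
        have e2 : min ((k : ℝ) + 1) R = k + 1 := min_eq_left (by exact_mod_cast hk)
        rw [e1] at ih
        rw [e2]
        linarith [h1 k]
      · have e1 : min ((k : ℝ)) R = R := min_eq_right (by exact_mod_cast hk)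
        have e2 : min ((k : ℝ) + 1) R = R := min_eq_right (by exact_mod_cast hk.trans (Nat.le_succ k))
        rw [e1] at ih
        rw [e2]
        linarith [h2 k hk]
  refine (key k).trans ?_
  gcongr
  exact min_le_right _ _

/-- On a finite measure space, the partial sums of a bounded weakly null sequence of integrable
functions have `L¹` norm `o(k)` when the indices are chosen inductively. -/
theorem exists_selection_integral_abs_sum_le [IsFiniteMeasure ν] {h : ℕ → α → ℝ}
    (hm : ∀ i, Measurable (h i)) (hi : ∀ i, Integrable (h i) ν)
    (hweak : ∀ v : α → ℝ, Measurable v → (∀ x, |v x| ≤ 1) →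
      Tendsto (fun i => ∫ x, h i x * v x ∂ν) atTop (𝓝 0))
    {M : ℝ} (hM : ∀ i, ∫ x, |h i x| ∂ν ≤ M) :
    ∃ P : Finset ℕ → ℕ → Prop, (∀ T, ∀ᶠ n in atTop, P T n) ∧
      ∀ i : ℕ → ℕ, StrictMono i → (∀ k, P ((Finset.range k).image i) (i k)) →
        ∀ ε > 0, ∀ᶠ k : ℕ in atTop, ∫ x, |∑ r ∈ Finset.range k, h (i r) x| ∂ν ≤ ε * k := by
  have hM0 : 0 ≤ M := (integral_nonneg fun x => abs_nonneg _).trans (hM 0)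
  -- The condition must not depend on `ε`. It therefore treats every smoothing parameter `l + 1`
  -- with `l ≤ T.card`, a finite list that eventually contains any given one, with a tolerance
  -- tending to zero.
  refine ⟨fun T n => ∀ l ∈ Finset.range (T.card + 1),
    ∫ x, (∑ s ∈ T, h s x) / √(((l : ℝ) + 1) ^ 2 + (∑ s ∈ T, h s x) ^ 2) * h n x ∂ν
      ≤ 1 / ((T.card : ℝ) + 1), fun T => ?_, fun i hmono hP ε hε => ?_⟩
  · refine (Filter.eventually_all_finset _).2 fun l _ => ?_
    have := hweak (fun x => (∑ s ∈ T, h s x) / √(((l : ℝ) + 1) ^ 2 + (∑ s ∈ T, h s x) ^ 2))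
      (by fun_prop) fun x => abs_div_sqrt_sq_add_sq_le_one _ _
    filter_upwards [this.eventually (gt_mem_nhds (by positivity :
      (0 : ℝ) < 1 / ((T.card : ℝ) + 1)))] with n hn
    refine le_of_eq_of_le ?_ hn.le
    simp only [mul_comm]
  -- Late steps incur three errors of at most `ε / 8`: the doubled tail `2 * (ε / 16)`, the
  -- quadratic term (choice of `l`) and the pairing (choice of `R₀`). The level `K`, from Markov's
  -- inequality, is fixed before `l`.
  obtain ⟨δ, hδ, N, hN⟩ := exists_forall_setIntegral_abs_le hm hi hweak
    (by positivity : 0 < ε / 16)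
  obtain ⟨K, hK, hKE⟩ : ∃ K > 0, ∀ n, ν {x | K < |h n x|} < δ := by
    obtain ⟨d, hd, hdδ⟩ := ENNReal.lt_iff_exists_nnreal_btwn.1 hδ
    have hd0 : (0 : ℝ) < d := by exact_mod_cast hd
    refine ⟨(M + 1) / d, by positivity, fun n => lt_of_le_of_lt ?_ hdδ⟩
    have hmarkov := mul_meas_ge_le_integral_of_nonneg
      (Eventually.of_forall fun x => abs_nonneg (h n x)) (hi n).abs ((M + 1) / d)
    have h1 : (M + 1) / d * ν.real {x | (M + 1) / d ≤ |h n x|} ≤ M + 1 := by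
      linarith [hM n]
    have h2 : ν.real {x | (M + 1) / d ≤ |h n x|} ≤ d := by
      rw [div_mul_eq_mul_div, div_le_iff₀ hd0] at h1
      exact le_of_mul_le_mul_left h1 (by positivity)
    calc ν {x | (M + 1) / d < |h n x|} ≤ ν {x | (M + 1) / d ≤ |h n x|} :=
          measure_mono (Set.ofPred_subset_ofPred.2 fun x => le_of_lt)
      _ ≤ ENNReal.ofReal d := by
          rw [← ENNReal.ofReal_toReal (measure_ne_top ν _)]
          exact ENNReal.ofReal_le_ofReal h2
      _ = d := ENNReal.ofReal_coe_nnreal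
  obtain ⟨l, hl⟩ := exists_nat_gt (K ^ 2 * ν.real Set.univ / (ε / 4))
  obtain ⟨R₀, hR₀⟩ := exists_nat_gt (1 / (ε / 8))
  set S : ℕ → α → ℝ := fun k x => ∑ r ∈ Finset.range k, h (i r) x with hSdef
  have hSi : ∀ k, Integrable (S k) ν := fun k => integrable_finsetSum _ fun r _ => hi (i r)
  have hSm : ∀ k, Measurable (S k) := fun k => by fun_prop
  have hSsucc : ∀ k x, S (k + 1) x = S k x + h (i k) x := fun k x => Finset.sum_range_succ _ _
  set L : ℝ := (l : ℝ) + 1 with hL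
  have hL0 : 0 < L := by positivity
  set A : ℕ → ℝ := fun k => ∫ x, √(L ^ 2 + S k x ^ 2) ∂ν with hA
  have step1 : ∀ k, A (k + 1) ≤ A k + M := fun k => by
    simp only [hA, hSsucc]
    exact (integral_sqrt_sq_add_add_sq_le_add_abs (hSi k) (hi _) L).trans
      (add_le_add_right (hM _) _)
  have step2 : ∀ k ≥ max N (max l R₀), A (k + 1) ≤ A k + ε / 2 := fun k hk => by
    have hkN : N ≤ k := (le_max_left _ _).trans hk
    have hkl : l ≤ k := (le_max_left _ _).trans ((le_max_right _ _).trans hk)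
    have hkR : R₀ ≤ k := (le_max_right _ _).trans ((le_max_right _ _).trans hk)
    have hcard : ((Finset.range k).image i).card = k := by
      rw [Finset.card_image_of_injective _ hmono.injective, Finset.card_range]
    have h1 := hP k l (by rw [hcard, Finset.mem_range]; omega)
    rw [hcard] at h1
    simp only [fun x => sum_image_range_of_strictMono (fun s => h s x) hmono k] at h1
    have h2 := integral_sqrt_sq_add_add_sq_le (hSi k) (hSm k) (hi (i k)) (hm (i k)) hL0 K
    have h3 := hN (i k) (hkN.trans (hmono.id_le k)) {x | K < |h (i k) x|}
      (measurableSet_lt measurable_const (by fun_prop)) (hKE _)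
    have h4 : K ^ 2 / (2 * L) * ν.real Set.univ ≤ ε / 8 := by
      rw [div_lt_iff₀ (by positivity)] at hl
      rw [div_mul_eq_mul_div, div_le_iff₀ (by positivity)]
      have : ε / 4 * l ≤ ε / 4 * L := by gcongr; linarith
      linarith
    have h5 : 1 / ((k : ℝ) + 1) ≤ ε / 8 := by
      rw [div_lt_iff₀ (by positivity)] at hR₀
      rw [div_le_iff₀ (by positivity)]
      have : ε / 8 * R₀ ≤ ε / 8 * (k + 1) := by
        gcongr
        exact_mod_cast hkR.trans (Nat.le_succ k)
      linarith
    simp only [hA, hSsucc]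
    linarith
  have hAk := le_add_mul_of_step hM0 (by positivity) step1 step2
  obtain ⟨k₀, hk₀⟩ := exists_nat_gt ((A 0 + (max N (max l R₀) : ℕ) * M) / (ε / 2))
  filter_upwards [eventually_ge_atTop k₀] with k hk
  have h1 : ∫ x, |S k x| ∂ν ≤ A k := integral_mono (hSi k).abs ((hSi k).sqrt_sq_add_sq L)
    fun x => Real.abs_le_sqrt (by nlinarith [sq_nonneg L])
  rw [div_lt_iff₀ (by positivity)] at hk₀
  have h2 : (k₀ : ℝ) * (ε / 2) ≤ k * (ε / 2) := by gcongr
  linarith [hAk k]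

end

/-! ### The case `p = 1` for arbitrary measures, and the two cases together. -/

section
variable {α : Type*} [MeasurableSpace α] {μ : Measure α}

theorem MeasureTheory.Lp.ae_sum_apply_eq {p : ℝ≥0∞} (f : ℕ → Lp ℝ p μ) (s : Finset ℕ) :
    ∀ᵐ x ∂μ, (∑ r ∈ s, f r : Lp ℝ p μ) x = ∑ r ∈ s, f r x := by
  classical
  induction s using Finset.induction_on with
  | empty => simpa using! Lp.coeFn_zero ℝ p μ
  | insert a s ha ih =>
    rw [Finset.sum_insert ha]
    filter_upwards [ih, Lp.coeFn_add (f a) (∑ r ∈ s, f r)] with x h1 h2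
    rw [h2, Pi.add_apply, h1, Finset.sum_insert ha]

theorem hasCesaroSelection_of_weaklyNull_one {f : ℕ → Lp ℝ 1 μ}
    (hf : ∀ v : Lp ℝ (ENNReal.conjExponent 1) μ,
      Tendsto (fun i => ∫ x, f i x * v x ∂μ) atTop (𝓝 0)) :
    HasCesaroSelection f := by
  obtain ⟨M, -, hfM⟩ := exists_norm_le_of_weaklyNull ENNReal.one_ne_top hf
  have hfm : ∀ i, Measurable (f i) := fun i => (Lp.stronglyMeasurable (f i)).measurable
  have hfi : ∀ i, Integrable (f i) μ := fun i => L1.integrable_coeFn (f i)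
  -- The weight `w = ∑ d i |f i|` is integrable and vanishes only where every `f i` does. So `f i ↦
  -- f i / w` preserves `L¹` norms into the finite measure `w μ`, with no σ-finiteness of `μ`.
  obtain ⟨d, hd, hdsum⟩ := ENNReal.exists_pos_tsum_mul_lt_of_countable one_ne_zero
    (fun i => ∫⁻ x, ‖f i x‖ₑ ∂μ) fun i => (hfi i).2.ne
  set w : α → ℝ≥0∞ := fun x => ∑' i, ‖f i x‖ₑ * d i with hw
  have hwm : Measurable w := by fun_prop
  have hwint : ∫⁻ x, w x ∂μ ≠ ∞ := by
    rw [hw, lintegral_tsum fun i => by fun_prop]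
    simp_rw [fun i => lintegral_mul_const (μ := μ) (d i : ℝ≥0∞) (hfm i).enorm]
    exact (hdsum.trans ENNReal.one_lt_top).ne
  have hwtop : ∀ᵐ x ∂μ, w x < ∞ := ae_lt_top hwm hwint
  have : IsFiniteMeasure (μ.withDensity w) := isFiniteMeasure_withDensity hwint
  set h : ℕ → α → ℝ := fun i x => f i x / (w x).toReal with hh
  have hmul : ∀ᵐ x ∂μ, ∀ i, (w x).toReal * h i x = f i x := by
    filter_upwards [hwtop] with x hx i
    rcases eq_or_ne (w x) 0 with h0 | h0
    · have := ENNReal.tsum_eq_zero.1 h0 i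
      have : f i x = 0 := by simpa [(hd i).ne'] using this
      simp [h0, this]
    · exact mul_div_cancel₀ _ (ENNReal.toReal_pos h0 hx.ne).ne'
  have hint : ∀ g : α → ℝ, ∫ x, g x ∂μ.withDensity w = ∫ x, (w x).toReal * g x ∂μ := fun g =>
    integral_withDensity_eq_integral_toReal_smul hwm hwtop g
  have hhm : ∀ i, Measurable (h i) := fun i => by fun_prop
  have hhi : ∀ i, Integrable (h i) (μ.withDensity w) := fun i => by
    rw [integrable_withDensity_iff_integrable_smul' hwm hwtop]
    exact (hfi i).congr (hmul.mono fun x hx => (hx i).symm)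
  have hhabs : ∀ i, ∫ x, |h i x| ∂μ.withDensity w ≤ M := fun i => by
    refine le_of_eq_of_le ?_ (hfM i)
    rw [hint, L1.norm_eq_integral_norm]
    refine integral_congr_ae (hmul.mono fun x hx => ?_)
    simp only
    rw [← hx i, Real.norm_eq_abs, abs_mul, abs_of_nonneg ENNReal.toReal_nonneg]
  have hweak : ∀ v : α → ℝ, Measurable v → (∀ x, |v x| ≤ 1) →
      Tendsto (fun i => ∫ x, h i x * v x ∂μ.withDensity w) atTop (𝓝 0) := by
    intro v hv hv1
    have hq : ENNReal.conjExponent 1 = ∞ := by simp [ENNReal.conjExponent]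
    have hvq : MemLp v (ENNReal.conjExponent 1) μ := by
      rw [hq]
      exact memLp_top_of_bound hv.aestronglyMeasurable 1 (Eventually.of_forall hv1)
    refine (hf (hvq.toLp v)).congr fun i => ?_
    rw [hint]
    refine integral_congr_ae ?_
    filter_upwards [hmul, hvq.coeFn_toLp] with x h1 h2
    rw [h2, ← h1 i, mul_assoc]
  obtain ⟨P, hP, hlim⟩ := exists_selection_integral_abs_sum_le hhm hhi hweak hhabs
  refine ⟨P, hP, fun i hi hPi => ?_⟩
  rw [Metric.tendsto_nhds]
  intro ε hε
  filter_upwards [hlim i hi hPi (ε / 2) (half_pos hε), eventually_gt_atTop 0] with k hk hk0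
  have hk0' : (0 : ℝ) < k := by exact_mod_cast hk0
  have hnorm : ‖∑ r ∈ Finset.range k, f (i r)‖ =
      ∫ x, |∑ r ∈ Finset.range k, h (i r) x| ∂μ.withDensity w := by
    rw [hint, L1.norm_eq_integral_norm]
    refine integral_congr_ae ?_
    filter_upwards [hmul, Lp.ae_sum_apply_eq (fun r => f (i r)) (Finset.range k)] with x h1 h2
    rw [h2, Real.norm_eq_abs, ← Finset.sum_congr rfl fun r _ => h1 (i r), ← Finset.mul_sum,
      abs_mul, abs_of_nonneg ENNReal.toReal_nonneg]
  rw [dist_zero_right, norm_smul, hnorm, Real.norm_of_nonneg (by positivity), one_div,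
    ← div_eq_inv_mul, div_lt_iff₀ hk0']
  refine hk.trans_lt ?_
  gcongr
  linarith

/-- Weakly null sequences in `L^p`, `1 ≤ p < ∞`, admit subsequences with Cesàro means tending to
zero in norm, and the subsequence can be selected index by index. -/
theorem hasCesaroSelection_of_weaklyNull {p : ℝ≥0∞} [Fact (1 ≤ p)] (hp : p ≠ ∞)
    {f : ℕ → Lp ℝ p μ} (hf : ∀ v : Lp ℝ (ENNReal.conjExponent p) μ,
      Tendsto (fun i => ∫ x, f i x * v x ∂μ) atTop (𝓝 0)) :
    HasCesaroSelection f := by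
  rcases eq_or_lt_of_le (Fact.out : 1 ≤ p) with rfl | h1
  · exact hasCesaroSelection_of_weaklyNull_one hf
  · exact hasCesaroSelection_of_weaklyNull_of_one_lt h1 hp hf

end

/-! ### Reduction to null sequences and passage to the product space. -/

theorem WeaklyConvergesLp.tendsto_integral_sub_mul {n : ℕ}
    {μ : Measure (EuclideanSpace ℝ (Fin n))} {p : ℝ≥0∞} [Fact (1 ≤ p)]
    {u : ℕ → Lp ℝ p μ} {u₀ : Lp ℝ p μ} (hu : WeaklyConvergesLp μ p u u₀)
    (v : Lp ℝ (ENNReal.conjExponent p) μ) :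
    Tendsto (fun i => ∫ x, (u i - u₀ : Lp ℝ p μ) x * v x ∂μ) atTop (𝓝 0) := by
  have h := (hu v).sub_const (∫ x, u₀ x * v x ∂μ)
  rw [sub_self] at h
  refine h.congr fun i => ?_
  have hint : ∀ g : Lp ℝ p μ, Integrable (fun x => g x * v x) μ := fun g =>
    (Lp.memLp g).integrable_mul (Lp.memLp v)
  rw [← integral_sub (hint _) (hint _)]
  refine integral_congr_ae ?_
  filter_upwards [Lp.coeFn_sub (u i) u₀] with x hx
  rw [hx, Pi.sub_apply, sub_mul]

theorem theorem1 (m n : ℕ) (μ : Measure (EuclideanSpace ℝ (Fin n)))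
    (p : ℝ≥0∞) [Fact (1 ≤ p)] (hp : p ≠ ∞)
    (u : ℕ → ProductLp m n μ p) (u₀ : ProductLp m n μ p)
    (hu : WeaklyConvergesProductLp μ p u u₀) :
    ∃ i : ℕ → ℕ, StrictMono i ∧
      Tendsto (fun k : ℕ => (1 / (k : ℝ)) • ∑ r ∈ Finset.range k, u (i r)) atTop (𝓝 u₀) := by
  obtain ⟨i, hi, hlim⟩ := exists_strictMono_of_forall_hasCesaroSelection
    (f := fun j k => u k j - u₀ j) fun j =>
      hasCesaroSelection_of_weaklyNull hp (hu j).tendsto_integral_sub_mul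
  refine ⟨i, hi, ?_⟩
  rw [(PiLp.homeomorph p fun _ : Fin m => Lp ℝ p μ).isInducing.tendsto_nhds_iff, tendsto_pi_nhds]
  intro j
  have h := (hlim j).add_const (u₀ j)
  rw [zero_add] at h
  refine h.congr' ?_
  -- At `k = 0` the mean is `0` because `1 / 0 = 0`, so the constant `u₀ j` averages to itself only
  -- for `k > 0`.
  filter_upwards [eventually_gt_atTop 0] with k hk
  have hk0 : (k : ℝ) ≠ 0 := by exact_mod_cast hk.ne'
  have hc : (1 / (k : ℝ)) • (k • u₀ j) = u₀ j := by
    rw [← Nat.cast_smul_eq_nsmul ℝ, smul_smul, one_div_mul_cancel hk0, one_smul]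
  simp only [Finset.sum_sub_distrib, smul_sub, Finset.sum_const, Finset.card_range, hc,
    sub_add_cancel]
  change _ = ((1 / (k : ℝ)) • ∑ r ∈ Finset.range k, u (i r)) j
  rw [PiLp.smul_apply, WithLp.ofLp_sum, Finset.sum_apply]
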